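/- Let $R$ be a commutative artinian ring and let $A$ be an artin $R$-algebra, that is, an (associative, unital) $R$-algebra which is finitely generated as an $R$-module. Assume that $A$ is connected, i.e. $0$ and $1$ are the only central idempotents of $A$, and that $\mathbf r^2=0$, where $\mathbf r$ is the Jacobson radical of $A$. Then $A$ is self-injective or CM-free (possibly both). Here $A$ is self-injective if the regular left module ${}_AA$ is injective, and CM-free if a finitely generated left $A$-module is Gorenstein-projective if and only if it is projective. A finitely generated left $A$-module $M$ is called Gorenstein-projective if there is an exact complex $P^\bullet=(\cdots\to P^{-1}\xrightarrow{d^{-1}}P^0\xrightarrow{d^0}P^1\to\cdots)$ of finitely generated projective left $A$-modules such that the complex $\operatorname{Hom}_A(P^\bullet,A)$ is also exact and $M\cong\ker d^0$. -/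

import Mathlib

open CategoryTheory

universe u

/-- `A` is connected: it is not a product of two nonzero rings, i.e. its only central idempotents
are `0` and `1`. (The zero ring is not excluded.) -/
def IsConnectedAlgebra (A : Type u) [Ring A] : Prop :=
  ∀ e ∈ Subring.center A, IsIdempotentElem e → e = 0 ∨ e = 1

/-- A totally acyclic complex of finitely generated projective left `A`-modules: the complex `P` is
exact, and so is the complex `Hom_A(P, A)`, whose differentials are precomposition with those
of `P`. -/
structure IsTotallyAcyclic {A : Type u} [Ring A] (P : CochainComplex (ModuleCat.{u} A) ℤ) :
    Prop where
  finite : ∀ n : ℤ, Module.Finite A (P.X n)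
  projective : ∀ n : ℤ, Module.Projective A (P.X n)
  exact : ∀ n : ℤ, Function.Exact (P.d n (n + 1)).hom (P.d (n + 1) (n + 1 + 1)).hom
  exact_dual : ∀ n : ℤ, Function.Exact
    (fun f : P.X (n + 1 + 1) →ₗ[A] A => f ∘ₗ (P.d (n + 1) (n + 1 + 1)).hom)
    (fun f : P.X (n + 1) →ₗ[A] A => f ∘ₗ (P.d n (n + 1)).hom)

/-- `M` is finitely generated Gorenstein-projective: it is isomorphic to the `0`-th cocycle module
of a totally acyclic complex of finitely generated projective modules. (Such an `M` is finitely
generated, being the image of the differential ending in degree `0`.) -/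
def IsGorensteinProjective (A : Type u) [Ring A] (M : Type u) [AddCommGroup M] [Module A M] :
    Prop :=
  ∃ P : CochainComplex (ModuleCat.{u} A) ℤ, IsTotallyAcyclic P ∧
    Nonempty (M ≃ₗ[A] LinearMap.ker (P.d 0 1).hom)

/-- `A` is CM-free: the finitely generated Gorenstein-projective left modules are exactly the
finitely generated projective ones. (Every finitely generated `A`-module is isomorphic to one in
the universe of `A`.) -/
def IsCMFree (A : Type u) [Ring A] : Prop :=
  ∀ (M : Type u) [AddCommGroup M] [Module A M] [Module.Finite A M],
    IsGorensteinProjective A M ↔ Module.Projective A M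

/-- `A` is self-injective: the left regular module is injective. -/
def IsSelfInjective (A : Type u) [Ring A] : Prop := Module.Injective A A

/-! Write `J` for the radical. A Gorenstein-projective `M` embeds in some `A^n` and has `Ext^k(M, A)
= 0` for `k > 0`. If `M` is not projective, a minimal nonprojective summand of it has no nonzero
projective summand, so it lies in `J A^n`. It is then killed by `J`, hence semisimple, and yields a
nonprojective simple module with the same vanishing (`exists_isAcyclicSimple`).

For such a simple `S` with projective cover `P`, maps from the syzygy `J P` to `A` extend to `P`,
and a map `P → A` that is nonzero on `J P` is injective. This forces `J P` to be simple,
nonprojective and again `Ext`-acyclic (`IsAcyclicSimple.ker`). Iterating gives a sequence of simples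
that returns to an earlier term. The idempotent separating the recurring simples from all others is
central (`exists_equiv_of_isConnectedAlgebra`), so by connectedness every simple occurs. Hence
`Ext^1(T, A) = 0` for all simple `T`, and Baer's criterion makes `A` injective. -/

open Abelian

/-! ### Vanishing of Ext into the regular module, and dimension shifting -/

section Ext

variable {A : Type u} [Ring A]

/-- All extension groups `Ext^n(M, A)` with `n > 0` vanish. -/
def ExtVanishes (A : Type u) [Ring A] (M : Type u) [AddCommGroup M] [Module A M] : Prop :=
  ∀ n : ℕ, Subsingleton (Ext (ModuleCat.of A M) (ModuleCat.of A A) (n + 1))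

variable {K N M : Type u} [AddCommGroup K] [Module A K] [AddCommGroup N] [Module A N]
  [AddCommGroup M] [Module A M]

theorem ExtVanishes.of_retract (h : ExtVanishes A M) (i : N →ₗ[A] M) (r : M →ₗ[A] N)
    (hri : r ∘ₗ i = LinearMap.id) : ExtVanishes A N := by
  intro n
  have := h n
  refine subsingleton_of_forall_eq 0 fun x ↦ ?_
  have hcomp : ModuleCat.ofHom i ≫ ModuleCat.ofHom r = 𝟙 (ModuleCat.of A N) := by
    rw [← ModuleCat.ofHom_comp, hri, ModuleCat.ofHom_id]
  have h1 : (Ext.mk₀ (ModuleCat.ofHom i)).comp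
      ((Ext.mk₀ (ModuleCat.ofHom r)).comp x (zero_add _)) (zero_add _) = x := by
    rw [Ext.mk₀_comp_mk₀_assoc, hcomp, Ext.mk₀_id_comp]
  rw [← h1, Subsingleton.elim ((Ext.mk₀ (ModuleCat.ofHom r)).comp x (zero_add _)) 0, Ext.comp_zero]

theorem ExtVanishes.of_equiv (h : ExtVanishes A M) (e : M ≃ₗ[A] N) : ExtVanishes A N :=
  h.of_retract e.symm.toLinearMap e.toLinearMap (by ext; simp)

theorem exists_shortExact (i : K →ₗ[A] N) (p : N →ₗ[A] M) (hi : Function.Injective i)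
    (hp : Function.Surjective p) (hip : Function.Exact i p) :
    ∃ w, (ShortComplex.mk (ModuleCat.ofHom i) (ModuleCat.ofHom p) w).ShortExact := by
  refine ⟨by rw [← ModuleCat.ofHom_comp, hip.linearMap_comp_eq_zero]; rfl, ?_⟩
  have hm : Mono (ModuleCat.ofHom i) := (ModuleCat.mono_iff_injective _).2 hi
  have he : Epi (ModuleCat.ofHom p) := (ModuleCat.epi_iff_surjective _).2 hp
  exact { exact := (ShortComplex.ShortExact.moduleCat_exact_iff_function_exact _).2 hip
          mono_f := hm
          epi_g := he }

/-- If `Ext^1(M, A) = 0`, linear forms extend along injections with cokernel `M`. -/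
theorem ExtVanishes.exists_extension (h : ExtVanishes A M) (i : K →ₗ[A] N) (p : N →ₗ[A] M)
    (hi : Function.Injective i) (hp : Function.Surjective p) (hip : Function.Exact i p)
    (f : K →ₗ[A] A) : ∃ g : N →ₗ[A] A, g ∘ₗ i = f := by
  obtain ⟨w, hS⟩ := exists_shortExact i p hi hp hip
  have := h 0
  obtain ⟨y, hy⟩ := Ext.contravariant_sequence_exact₁ hS (ModuleCat.of A A)
    (Ext.mk₀ (ModuleCat.ofHom f)) (n₁ := 0 + 1) rfl (Subsingleton.elim _ _)
  obtain ⟨g, rfl⟩ := Ext.addEquiv₀.symm.surjective y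
  refine ⟨g.hom, ?_⟩
  have h2 : ModuleCat.ofHom i ≫ g = ModuleCat.ofHom f := by
    apply Ext.addEquiv₀.symm.injective
    simpa using hy
  exact congrArg ModuleCat.Hom.hom h2

theorem ExtVanishes.of_shortExact (h : ExtVanishes A M) (i : K →ₗ[A] N) (p : N →ₗ[A] M)
    (hi : Function.Injective i) (hp : Function.Surjective p) (hip : Function.Exact i p)
    [Module.Projective A N] : ExtVanishes A K := by
  obtain ⟨w, hS⟩ := exists_shortExact i p hi hp hip
  intro n
  have := h (n + 1)
  refine subsingleton_of_forall_eq 0 fun x ↦ ?_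
  obtain ⟨y, hy⟩ := Ext.contravariant_sequence_exact₁ hS (ModuleCat.of A A) x
    (n₁ := n + 1 + 1) (add_comm _ _) (Subsingleton.elim _ _)
  have : Projective (ModuleCat.of A N) := (IsProjective.iff_projective N).1 inferInstance
  rw [← hy, Ext.eq_zero_of_projective (P := ModuleCat.of A N) y, Ext.comp_zero]

/-- Since `N` is projective, each class is the extension class pushed out along some `f : K → A`; it
dies as soon as `f` factors through `i`. -/
theorem subsingleton_ext_one (i : K →ₗ[A] N) (p : N →ₗ[A] M)
    (hi : Function.Injective i) (hp : Function.Surjective p) (hip : Function.Exact i p)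
    [Module.Projective A N] (hext : ∀ f : K →ₗ[A] A, ∃ g : N →ₗ[A] A, g ∘ₗ i = f) :
    Subsingleton (Ext (ModuleCat.of A M) (ModuleCat.of A A) 1) := by
  obtain ⟨w, hS⟩ := exists_shortExact i p hi hp hip
  have : Projective (ModuleCat.of A N) := (IsProjective.iff_projective N).1 inferInstance
  refine subsingleton_of_forall_eq 0 fun x ↦ ?_
  obtain ⟨y, hy⟩ := Ext.contravariant_sequence_exact₃ hS (ModuleCat.of A A) x
    (Ext.eq_zero_of_projective (P := ModuleCat.of A N) _) (n₀ := 0) rfl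
  obtain ⟨f, rfl⟩ := Ext.addEquiv₀.symm.surjective y
  obtain ⟨g, hg⟩ := hext f.hom
  have h2 : ModuleCat.ofHom i ≫ ModuleCat.ofHom g = f := by
    rw [← ModuleCat.ofHom_comp, hg]; rfl
  rw [← hy, ← h2]
  have h3 : Ext.addEquiv₀.symm (ModuleCat.ofHom i ≫ ModuleCat.ofHom g) =
    (Ext.mk₀ (ModuleCat.ofHom i)).comp (Ext.mk₀ (ModuleCat.ofHom g)) (zero_add 0) := by simp
  rw [h3]
  exact hS.extClass_comp_assoc _

theorem subsingleton_ext_succ (i : K →ₗ[A] N) (p : N →ₗ[A] M)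
    (hi : Function.Injective i) (hp : Function.Surjective p) (hip : Function.Exact i p)
    [Module.Projective A N] {n : ℕ}
    (hK : Subsingleton (Ext (ModuleCat.of A K) (ModuleCat.of A A) (n + 1))) :
    Subsingleton (Ext (ModuleCat.of A M) (ModuleCat.of A A) (n + 1 + 1)) := by
  obtain ⟨w, hS⟩ := exists_shortExact i p hi hp hip
  have : Projective (ModuleCat.of A N) := (IsProjective.iff_projective N).1 inferInstance
  refine subsingleton_of_forall_eq 0 fun x ↦ ?_
  obtain ⟨y, rfl⟩ := Ext.contravariant_sequence_exact₃ hS (ModuleCat.of A A) x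
    (Ext.eq_zero_of_projective (P := ModuleCat.of A N) _) (n₀ := n + 1) (add_comm _ _)
  rw [Subsingleton.elim y 0, Ext.comp_zero]

end Ext

/-! ### Totally acyclic complexes and Gorenstein-projective modules -/

section Complex

variable {A : Type u} [Ring A] {P : CochainComplex (ModuleCat.{u} A) ℤ}

theorem d_apply_d (n : ℤ) (x : P.X n) :
    (P.d (n + 1) (n + 1 + 1)).hom ((P.d n (n + 1)).hom x) = 0 := by
  rw [← LinearMap.comp_apply, ← ModuleCat.hom_comp, P.d_comp_d]; rfl

/-- The differential of a complex, with values in the cocycles. -/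
def toCocycles (P : CochainComplex (ModuleCat.{u} A) ℤ) (n : ℤ) :
    P.X n →ₗ[A] LinearMap.ker (P.d (n + 1) (n + 1 + 1)).hom :=
  (P.d n (n + 1)).hom.codRestrict _ fun x ↦ d_apply_d n x

theorem IsTotallyAcyclic.toCocycles_surjective (hP : IsTotallyAcyclic P) (n : ℤ) :
    Function.Surjective (toCocycles P n) := by
  rintro ⟨y, hy⟩
  obtain ⟨x, hx⟩ := (hP.exact n y).1 hy
  exact ⟨x, Subtype.ext hx⟩

theorem exact_toCocycles (n : ℤ) :
    Function.Exact (LinearMap.ker (P.d n (n + 1)).hom).subtype (toCocycles P n) := by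
  rw [LinearMap.exact_iff, Submodule.range_subtype]
  exact LinearMap.ker_codRestrict _ _ _

/-- Composed with the differential onto the cocycles, `f` vanishes on coboundaries, so exactness of
the dual complex factors it through the next term. -/
theorem IsTotallyAcyclic.exists_extension (hP : IsTotallyAcyclic P) (n : ℤ)
    (f : LinearMap.ker (P.d (n + 1 + 1) (n + 1 + 1 + 1)).hom →ₗ[A] A) :
    ∃ g : P.X (n + 1 + 1) →ₗ[A] A, g ∘ₗ (Submodule.subtype _) = f := by
  have h0 : (f ∘ₗ toCocycles P (n + 1)) ∘ₗ (P.d n (n + 1)).hom = 0 := by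
    ext x
    have : toCocycles P (n + 1) ((P.d n (n + 1)).hom x) = 0 := Subtype.ext (d_apply_d n x)
    simp only [LinearMap.comp_apply, this, map_zero, LinearMap.zero_apply]
  obtain ⟨g, hg⟩ := (hP.exact_dual n _).1 h0
  refine ⟨g, LinearMap.ext fun z ↦ ?_⟩
  obtain ⟨x, rfl⟩ := hP.toCocycles_surjective (n + 1) z
  exact LinearMap.congr_fun hg x

theorem IsTotallyAcyclic.extVanishes (hP : IsTotallyAcyclic P) (n : ℤ) :
    ExtVanishes A (LinearMap.ker (P.d n (n + 1)).hom) := by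
  intro k
  have key (n : ℤ) := exact_toCocycles (P := P) n
  induction k generalizing n with
  | zero =>
    -- The cocycles in degree `m + 3` are presented by the term in degree `m + 2`, where
    -- `exists_extension m` applies.
    obtain ⟨n, rfl⟩ : ∃ m, n = m + 1 + 1 + 1 := ⟨n - 3, by ring⟩
    have := hP.projective (n + 1 + 1)
    exact subsingleton_ext_one _ _ (Submodule.subtype_injective _)
      (hP.toCocycles_surjective _) (key _) (hP.exists_extension n)
  | succ k ih =>
    obtain ⟨n, rfl⟩ : ∃ m, n = m + 1 := ⟨n - 1, by ring⟩
    have := hP.projective n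
    exact subsingleton_ext_succ _ _ (Submodule.subtype_injective _)
      (hP.toCocycles_surjective _) (key _) (ih n)

/-- The complex with all terms `M × M` and differential `(a, b) ↦ (b, 0)`. -/
noncomputable def shiftComplex (A M : Type u) [Ring A] [AddCommGroup M] [Module A M] :
    CochainComplex (ModuleCat.{u} A) ℤ :=
  CochainComplex.of (fun _ ↦ ModuleCat.of A (M × M))
    (fun _ ↦ ModuleCat.ofHom (LinearMap.inl A M M ∘ₗ LinearMap.snd A M M))
    (fun _ ↦ by ext x <;> simp)

theorem shiftComplex_d (M : Type u) [AddCommGroup M] [Module A M] (n : ℤ) :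
    ((shiftComplex A M).d n (n + 1)).hom = LinearMap.inl A M M ∘ₗ LinearMap.snd A M M :=
  congrArg ModuleCat.Hom.hom (CochainComplex.of_d (fun _ : ℤ ↦ ModuleCat.of A (M × M))
    (fun _ ↦ ModuleCat.ofHom (LinearMap.inl A M M ∘ₗ LinearMap.snd A M M)) n)

/-- Kernel and image of the differential are both `M × 0`, and the dual splits likewise. Equal terms
in all degrees avoid a case split on the degree. -/
theorem isTotallyAcyclic_shiftComplex (M : Type u) [AddCommGroup M] [Module A M]
    [Module.Finite A M] [Module.Projective A M] : IsTotallyAcyclic (shiftComplex A M) where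
  finite _ := inferInstanceAs (Module.Finite A (M × M))
  projective _ := inferInstanceAs (Module.Projective A (M × M))
  exact n := by
    rw [shiftComplex_d, shiftComplex_d]
    rintro ⟨a, b⟩
    constructor
    · intro h
      have hb : b = 0 := congrArg Prod.fst h
      exact ⟨(0, a), by subst hb; rfl⟩
    · rintro ⟨⟨c, d⟩, h⟩
      have hb : b = 0 := (congrArg Prod.snd h).symm
      subst hb; rfl
  exact_dual n := by
    rw [shiftComplex_d, shiftComplex_d]
    intro (f : M × M →ₗ[A] A)
    constructor
    · intro h
      refine ⟨f ∘ₗ LinearMap.inr A M M ∘ₗ LinearMap.fst A M M, ?_⟩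
      refine LinearMap.ext fun (x : M × M) ↦ ?_
      have h1 : f (x.1, 0) = 0 := LinearMap.congr_fun h (0, x.1)
      have h2 : f x = f (x.1, 0) + f (0, x.2) := by
        rw [← map_add]; congr 1; ext <;> simp
      rw [h1, zero_add] at h2
      exact h2.symm
    · rintro ⟨g, rfl⟩
      refine LinearMap.ext fun x ↦ ?_
      exact map_zero g

theorem IsGorensteinProjective.of_projective (M : Type u) [AddCommGroup M] [Module A M]
    [Module.Finite A M] [Module.Projective A M] : IsGorensteinProjective A M := by
  refine ⟨shiftComplex A M, isTotallyAcyclic_shiftComplex M, ⟨?_⟩⟩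
  have h : ((shiftComplex A M).d 0 1).hom = LinearMap.inl A M M ∘ₗ LinearMap.snd A M M :=
    shiftComplex_d M 0
  have hker : LinearMap.range (LinearMap.inl A M M) =
      LinearMap.ker (LinearMap.inl A M M ∘ₗ LinearMap.snd A M M) := by
    rw [LinearMap.ker_comp_of_ker_eq_bot _ (LinearMap.ker_eq_bot.2 LinearMap.inl_injective),
      LinearMap.range_inl]
  have e : M ≃ₗ[A] LinearMap.ker (LinearMap.inl A M M ∘ₗ LinearMap.snd A M M) :=
    (LinearEquiv.ofInjective (LinearMap.inl A M M) LinearMap.inl_injective).trans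
      (LinearEquiv.ofEq _ _ hker)
  rw [h]
  exact e

end Complex

/-! ### Projective covers of simple modules in radical square zero -/

section ProjectiveCover

variable {A : Type u} [Ring A] {P Q S T : Type u} [AddCommGroup P] [Module A P]
  [AddCommGroup Q] [Module A Q] [AddCommGroup S] [Module A S] [AddCommGroup T] [Module A T]

/-- A surjection from a projective module whose kernel is the radical `J P` of its domain. When
`J` is nilpotent, this is a projective cover. -/
structure IsRadicalCover (π : P →ₗ[A] S) : Prop where
  projective : Module.Projective A P
  surjective : Function.Surjective π
  ker_eq : LinearMap.ker π = Ring.jacobson A • (⊤ : Submodule A P)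

theorem mul_eq_zero_of_mem_jacobson (hJ : Ring.jacobson A * Ring.jacobson A = ⊥) {x y : A}
    (hx : x ∈ Ring.jacobson A) (hy : y ∈ Ring.jacobson A) : x * y = 0 := by
  have := Ideal.mul_mem_mul hx hy
  rwa [hJ] at this

theorem smul_eq_zero_of_mem_jacobson [IsSimpleModule A S] {x : A} (hx : x ∈ Ring.jacobson A)
    (s : S) : x • s = 0 :=
  Module.mem_annihilator.1 (IsSemisimpleModule.jacobson_le_annihilator A S hx) s

theorem isSemisimpleModule_of_jacobson_smul [IsArtinianRing A]
    (h : ∀ x ∈ Ring.jacobson A, ∀ s : S, x • s = 0) : IsSemisimpleModule A S := by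
  have hM : Module.IsTorsionBySet A S (Ring.jacobson A) := fun s x ↦ h x x.2 s
  let := hM.module
  exact hM.isSemisimpleModule_iff.1 inferInstance

/-- Idempotents lift modulo the Jacobson radical. -/
theorem exists_idempotent_sub_mem_jacobson (hJ : Ring.jacobson A * Ring.jacobson A = ⊥) {v : A}
    (hv : v * (1 - v) ∈ Ring.jacobson A) :
    ∃ f : A, IsIdempotentElem f ∧ f - v ∈ Ring.jacobson A := by
  obtain ⟨f, hf, hfv⟩ := exists_isIdempotentElem_eq_of_ker_isNilpotent
    (Ideal.Quotient.mk (Ring.jacobson A)) (fun x hx ↦ by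
      rw [Ideal.mk_ker] at hx
      exact ⟨2, by rw [pow_two, mul_eq_zero_of_mem_jacobson hJ hx hx]⟩)
    (Ideal.Quotient.mk _ v) ⟨v, rfl⟩ (by
      rw [IsIdempotentElem, ← map_mul, eq_comm, Ideal.Quotient.eq]
      rwa [mul_sub, mul_one] at hv)
  exact ⟨f, hf, Ideal.Quotient.eq.1 hfv⟩

namespace IsRadicalCover

variable {π : P →ₗ[A] S}

theorem smul_eq_zero (hJ : Ring.jacobson A * Ring.jacobson A = ⊥) (hπ : IsRadicalCover π)
    {j : A} (hj : j ∈ Ring.jacobson A) {x : P} (hx : x ∈ LinearMap.ker π) : j • x = 0 := by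
  rw [hπ.ker_eq] at hx
  refine Submodule.smul_induction_on hx (fun a ha p _ ↦ ?_) fun x y hx hy ↦ ?_
  · rw [smul_smul, mul_eq_zero_of_mem_jacobson hJ hj ha, zero_smul]
  · rw [smul_add, hx, hy, add_zero]

/-- Nakayama by hand: `J P = J (N + J P) = J N ≤ N`, because `J² = 0`. -/
theorem eq_top_of_sup_ker (hJ : Ring.jacobson A * Ring.jacobson A = ⊥) (hπ : IsRadicalCover π)
    {N : Submodule A P} (hN : N ⊔ LinearMap.ker π = ⊤) : N = ⊤ := by
  rw [eq_top_iff, ← hN, sup_le_iff]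
  refine ⟨le_rfl, ?_⟩
  conv_lhs => rw [hπ.ker_eq]
  refine Submodule.smul_le.2 fun j hj p _ ↦ ?_
  obtain ⟨n, hn, k, hk, rfl⟩ := Submodule.mem_sup.1 (hN ▸ Submodule.mem_top : p ∈ N ⊔ _)
  rw [smul_add, hπ.smul_eq_zero hJ hj hk, add_zero]
  exact N.smul_mem j hn

theorem surjective_of_comp (hJ : Ring.jacobson A * Ring.jacobson A = ⊥) (hπ : IsRadicalCover π)
    {g : Q →ₗ[A] P} (hg : Function.Surjective (π ∘ₗ g)) : Function.Surjective g := by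
  rw [← LinearMap.range_eq_top]
  refine hπ.eq_top_of_sup_ker hJ (eq_top_iff.2 fun p _ ↦ ?_)
  obtain ⟨q, hq⟩ := hg (π p)
  refine Submodule.mem_sup.2 ⟨g q, ⟨q, rfl⟩, p - g q, ?_, by abel⟩
  rw [LinearMap.mem_ker, map_sub, ← hq, LinearMap.comp_apply, sub_self]

/-- Every nonzero map from a projective cover of a simple module to a simple module is the
covering map up to isomorphism. -/
theorem exists_equiv [IsSimpleModule A S] [IsSimpleModule A T] (hπ : IsRadicalCover π)
    {g : P →ₗ[A] T} (hg : g ≠ 0) : ∃ e : S ≃ₗ[A] T, e.toLinearMap ∘ₗ π = g := by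
  have hle : LinearMap.ker π ≤ LinearMap.ker g := by
    rw [hπ.ker_eq]
    refine Submodule.smul_le.2 fun j hj p _ ↦ ?_
    rw [LinearMap.mem_ker, map_smul, smul_eq_zero_of_mem_jacobson hj]
  let h : S →ₗ[A] T := (LinearMap.ker π).liftQ g hle ∘ₗ
    (π.quotKerEquivOfSurjective hπ.surjective).symm.toLinearMap
  have hh : h ∘ₗ π = g := by
    ext p
    have : (π.quotKerEquivOfSurjective hπ.surjective).symm (π p) = (LinearMap.ker π).mkQ p := by
      rw [LinearEquiv.symm_apply_eq]; rfl
    simp [h, this]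
  have h0 : h ≠ 0 := by
    rintro h0
    exact hg (by rw [← hh, h0, LinearMap.zero_comp])
  exact ⟨LinearEquiv.ofBijective h (LinearMap.bijective_of_ne_zero h0), hh⟩

/-- A linear form on a projective cover of a simple module that does not vanish on the radical
recovers the covering map. -/
theorem exists_comp_eq (hJ : Ring.jacobson A * Ring.jacobson A = ⊥) [IsSimpleModule A S]
    (hπ : IsRadicalCover π) (f : P →ₗ[A] A) {x : P} (hx : x ∈ LinearMap.ker π) (hfx : f x ≠ 0) :
    ∃ φ : A →ₗ[A] S, φ ∘ₗ f = π := by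
  -- If `f` took values in `J`, it would send `J P` into `J² = 0`.
  obtain ⟨p, hp⟩ : ∃ p, f p ∉ Ring.jacobson A := by
    by_contra! h
    refine hfx ?_
    rw [hπ.ker_eq] at hx
    refine Submodule.smul_induction_on hx (fun a ha p _ ↦ ?_) fun x y hx hy ↦ ?_
    · rw [map_smul, smul_eq_mul, mul_eq_zero_of_mem_jacobson hJ ha (h p)]
    · rw [map_add, hx, hy, add_zero]
  rw [Ring.jacobson_eq_sInf_isMaximal, Submodule.mem_sInf] at hp
  push Not at hp
  obtain ⟨m, hm, hpm⟩ := hp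
  have : IsSimpleModule A (A ⧸ m) := isSimpleModule_iff_isCoatom.2 (Ideal.isMaximal_def.1 hm)
  obtain ⟨e, he⟩ := hπ.exists_equiv (g := m.mkQ ∘ₗ f) (fun h ↦ hpm (by
    simpa using LinearMap.congr_fun h p))
  refine ⟨e.symm.toLinearMap ∘ₗ m.mkQ, ?_⟩
  rw [LinearMap.comp_assoc, ← he]
  ext; simp

/-- Lifting `φ` through `π` gives `ψ` with `ψ ∘ f` a surjective endomorphism of a noetherian module,
hence injective. -/
theorem injective_of_apply_ne_zero [IsNoetherianRing A] [Module.Finite A P]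
    (hJ : Ring.jacobson A * Ring.jacobson A = ⊥) [IsSimpleModule A S]
    (hπ : IsRadicalCover π) (f : P →ₗ[A] A) {x : P} (hx : x ∈ LinearMap.ker π) (hfx : f x ≠ 0) :
    Function.Injective f := by
  obtain ⟨φ, hφ⟩ := hπ.exists_comp_eq hJ f hx hfx
  obtain ⟨ψ, hψ⟩ := Module.projective_lifting_property π φ hπ.surjective
  have hs : Function.Surjective (ψ ∘ₗ f) := hπ.surjective_of_comp hJ (by
    rw [← LinearMap.comp_assoc, hψ, hφ]
    exact hπ.surjective)
  have hi := IsNoetherian.injective_of_surjective_endomorphism (ψ ∘ₗ f) hs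
  exact Function.Injective.of_comp hi

end IsRadicalCover

/-- Every simple module has a projective cover generated by an idempotent. -/
theorem exists_isRadicalCover [IsArtinianRing A] (hJ : Ring.jacobson A * Ring.jacobson A = ⊥)
    (S : Type u) [AddCommGroup S] [Module A S] [IsSimpleModule A S] :
    ∃ f : A, IsIdempotentElem f ∧
      ∃ π : Submodule.span A {f} →ₗ[A] S, IsRadicalCover π := by
  have := IsSimpleModule.nontrivial A S
  obtain ⟨t, ht⟩ := exists_ne (0 : S)
  set J := Ring.jacobson A
  have hss : IsSemisimpleModule A (A ⧸ J) := isSemisimpleModule_of_jacobson_smul fun x hx s ↦ by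
    obtain ⟨a, rfl⟩ := J.mkQ_surjective s
    rw [← map_smul, Submodule.mkQ_apply, Submodule.Quotient.mk_eq_zero, smul_eq_mul]
    exact J.mul_mem_right _ hx
  set m : Submodule A A := LinearMap.ker (LinearMap.toSpanSingleton A S t)
  have hm (a : A) : a ∈ m ↔ a • t = 0 := by simp [m]
  -- The component `v` of `1` in a complement of `m` modulo `J` is idempotent modulo `J` and fixes
  -- `t`; the required `f` lifts it.
  obtain ⟨C, hC⟩ := exists_isCompl (m.map J.mkQ)
  obtain ⟨_, ⟨w, hw, rfl⟩, c, hc, hwc⟩ := Submodule.mem_sup.1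
    (hC.sup_eq_top ▸ Submodule.mem_top : J.mkQ 1 ∈ m.map J.mkQ ⊔ C)
  obtain ⟨v, rfl⟩ : ∃ v, w = 1 - v := ⟨1 - w, by abel⟩
  have hv : J.mkQ v ∈ C := by
    rw [map_sub] at hwc
    have : c = J.mkQ v := by
      rw [sub_add_eq_add_sub, sub_eq_iff_eq_add] at hwc
      exact add_left_cancel hwc
    rwa [← this]
  have hmem {a : A} (ha : a ∈ m) (haC : J.mkQ a ∈ C) : a ∈ J := by
    have := (Submodule.disjoint_def.1 hC.disjoint) _ ⟨a, ha, rfl⟩ haC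
    rwa [Submodule.mkQ_apply, Submodule.Quotient.mk_eq_zero] at this
  have hvt : v • t = t := by
    have := (hm _).1 hw
    rw [sub_smul, one_smul, sub_eq_zero] at this
    exact this.symm
  obtain ⟨f, hf, hfv⟩ := exists_idempotent_sub_mem_jacobson hJ (v := v) (hmem
    (m.smul_mem v hw) (by
      rw [mul_sub, mul_one, map_sub]
      exact C.sub_mem hv (C.smul_mem v hv)))
  have hft : f • t = t := by
    have := smul_eq_zero_of_mem_jacobson hfv t
    rwa [sub_smul, hvt, sub_eq_zero] at this
  refine ⟨f, hf, (LinearMap.toSpanSingleton A S t).domRestrict _, ?_, ?_, ?_⟩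
  · refine Module.Projective.of_split (Submodule.span A {f}).subtype
      ((LinearMap.toSpanSingleton A A f).codRestrict _ fun a ↦
        Submodule.smul_mem _ _ (Submodule.mem_span_singleton_self f)) ?_
    ext ⟨x, hx⟩
    obtain ⟨a, rfl⟩ := Submodule.mem_span_singleton.1 hx
    change (a * f) * f = a * f
    rw [mul_assoc, hf.eq]
  · intro s
    obtain ⟨a, rfl⟩ := IsSimpleModule.toSpanSingleton_surjective A ht s
    refine ⟨⟨a • f, Submodule.smul_mem _ _ (Submodule.mem_span_singleton_self f)⟩, ?_⟩
    simp [mul_smul, hft]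
  · refine le_antisymm ?_ (Submodule.smul_le.2 fun j hj p _ ↦ ?_)
    · rintro ⟨x, hx⟩ hxt
      obtain ⟨a, rfl⟩ := Submodule.mem_span_singleton.1 hx
      have hat : a • t = 0 := by simpa [mul_smul, hft] using hxt
      have hav : a * v ∈ J := by
        refine hmem ?_ (C.smul_mem a hv)
        rw [hm, mul_smul, hvt, hat]
      have haf : a * f ∈ J := by
        have := J.add_mem (J.mul_mem_left a hfv) hav
        rwa [mul_sub, sub_add_cancel] at this
      have heq : (⟨a • f, hx⟩ : Submodule.span A {f}) =
          (a * f) • ⟨f, Submodule.mem_span_singleton_self f⟩ :=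
        Subtype.ext (by simp [mul_assoc, hf.eq])
      rw [heq]
      exact Submodule.smul_mem_smul haf Submodule.mem_top
    · rw [LinearMap.mem_ker, map_smul, smul_eq_zero_of_mem_jacobson hj]

/-- The idempotent `f` of a cover of `T` acts nontrivially on `T`, hence on some `S i`. This gives a
nonzero map `A f → S i`, which forces `T ≅ S i`. -/
theorem exists_equiv_of_iInf_annihilator_le [IsArtinianRing A]
    (hJ : Ring.jacobson A * Ring.jacobson A = ⊥) {ι : Type*} (S : ι → Type u)
    [∀ i, AddCommGroup (S i)] [∀ i, Module A (S i)] [∀ i, IsSimpleModule A (S i)]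
    [IsSimpleModule A T] (h : ⨅ i, Module.annihilator A (S i) ≤ Module.annihilator A T) :
    ∃ i, Nonempty (T ≃ₗ[A] S i) := by
  obtain ⟨f, hf, π, hπ⟩ := exists_isRadicalCover hJ T
  have hfT : f ∉ Module.annihilator A T := by
    intro hfT
    have := IsSimpleModule.nontrivial A T
    obtain ⟨t, ht⟩ := exists_ne (0 : T)
    obtain ⟨⟨x, hx⟩, rfl⟩ := hπ.surjective t
    obtain ⟨a, rfl⟩ := Submodule.mem_span_singleton.1 hx
    refine ht ?_
    have heq : (⟨a • f, hx⟩ : Submodule.span A {f}) =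
        a • f • ⟨f, Submodule.mem_span_singleton_self f⟩ :=
      Subtype.ext (by simp [hf.eq])
    rw [heq, map_smul, map_smul, Module.mem_annihilator.1 hfT, smul_zero]
  have hfS : ¬ f ∈ ⨅ i, Module.annihilator A (S i) := fun h' ↦ hfT (h h')
  simp only [Submodule.mem_iInf, Module.mem_annihilator] at hfS
  push Not at hfS
  obtain ⟨i, s, hs⟩ := hfS
  obtain ⟨e, -⟩ := hπ.exists_equiv
    (g := (LinearMap.toSpanSingleton A (S i) s).domRestrict (Submodule.span A {f}))
    (fun h ↦ hs (by
      simpa using LinearMap.congr_fun h ⟨f, Submodule.mem_span_singleton_self f⟩))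
  exact ⟨i, ⟨e⟩⟩

end ProjectiveCover

/-! ### Acyclic simple modules, their syzygies and their existence -/

section AcyclicSimple

variable {A : Type u} [Ring A]

/-- A simple nonprojective module `S` with `Ext^n(S, A) = 0` for all `n > 0`. -/
structure IsAcyclicSimple (A : Type u) [Ring A] (S : Type u) [AddCommGroup S] [Module A S] :
    Prop where
  simple : IsSimpleModule A S
  not_projective : ¬ Module.Projective A S
  extVanishes : ExtVanishes A S

variable {P S : Type u} [AddCommGroup P] [Module A P] [AddCommGroup S] [Module A S]

/-- The syzygy of an acyclic simple module is again acyclic and simple. -/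
theorem IsAcyclicSimple.ker [IsArtinianRing A] (hJ : Ring.jacobson A * Ring.jacobson A = ⊥)
    [Module.Finite A P] (hS : IsAcyclicSimple A S) {π : P →ₗ[A] S} (hπ : IsRadicalCover π)
    (ι : P →ₗ[A] A) (hι : Function.Injective ι) : IsAcyclicSimple A (LinearMap.ker π) := by
  have := hS.simple
  have := hπ.projective
  set K := LinearMap.ker π
  have hext (f : K →ₗ[A] A) : ∃ g : P →ₗ[A] A, g ∘ₗ K.subtype = f :=
    hS.extVanishes.exists_extension K.subtype π K.subtype_injective hπ.surjective
      (LinearMap.exact_subtype_ker_map π) f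
  have hK : Nontrivial K := by
    rw [Submodule.nontrivial_iff_ne_bot]
    intro h
    exact hS.not_projective (Module.Projective.of_equiv
      (LinearEquiv.ofBijective π ⟨LinearMap.ker_eq_bot.1 h, hπ.surjective⟩))
  have hss : IsSemisimpleModule A K := isSemisimpleModule_of_jacobson_smul fun j hj k ↦
    Subtype.ext (hπ.smul_eq_zero hJ hj k.2)
  have hsimple : IsSimpleModule A K := by
    obtain ⟨T, hT⟩ := IsSemisimpleModule.exists_simple_submodule A K
    obtain ⟨r, hr⟩ := IsSemisimpleModule.extension_property T.subtype T.subtype_injective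
      LinearMap.id
    -- Extend the projection of `K` onto its simple summand `T`. The extension is injective on `P`,
    -- so `r` is injective and `K ≅ T`.
    obtain ⟨g, hg⟩ := hext (ι ∘ₗ K.subtype ∘ₗ T.subtype ∘ₗ r)
    have hg' (k : K) : g k = ι (r k : K) := LinearMap.congr_fun hg k
    have := IsSimpleModule.nontrivial A T
    obtain ⟨t, ht⟩ := exists_ne (0 : T)
    have hrt : r t = t := LinearMap.congr_fun hr t
    have hinj : Function.Injective g := by
      refine hπ.injective_of_apply_ne_zero hJ g (x := (t : K)) (t : K).2 fun h0 ↦ ht ?_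
      rw [hg', hrt] at h0
      exact Subtype.ext (Subtype.ext ((map_eq_zero_iff ι hι).1 h0))
    refine IsSimpleModule.congr (N := T) (LinearEquiv.ofBijective r ⟨?_, fun t ↦
      ⟨t, LinearMap.congr_fun hr t⟩⟩)
    refine (injective_iff_map_eq_zero r).2 fun k hk ↦ Subtype.ext (hinj ?_)
    rw [hg', hk]
    simp
  refine ⟨hsimple, fun hproj ↦ ?_, hS.extVanishes.of_shortExact K.subtype π K.subtype_injective
    hπ.surjective (LinearMap.exact_subtype_ker_map π)⟩
  obtain ⟨k, hk⟩ := exists_ne (0 : K)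
  -- Were `K` projective, it would embed in `A` as a summand, and extending this embedding would
  -- retract `P` onto `K = J P`, against Nakayama.
  obtain ⟨s, hs⟩ := Module.projective_lifting_property (LinearMap.toSpanSingleton A K k)
    LinearMap.id (IsSimpleModule.toSpanSingleton_surjective A hk)
  obtain ⟨g, hg⟩ := hext s
  set h : P →ₗ[A] K := LinearMap.toSpanSingleton A K k ∘ₗ g
  have hh (x : K) : h x = x := by
    have h1 : g x = s x := LinearMap.congr_fun hg x
    have h2 := LinearMap.congr_fun hs x
    rw [LinearMap.comp_apply, ← h1] at h2
    exact h2
  have htop : LinearMap.ker h = ⊤ := by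
    refine hπ.eq_top_of_sup_ker hJ (eq_top_iff.2 fun p _ ↦ ?_)
    refine Submodule.mem_sup.2 ⟨p - h p, ?_, h p, (h p).2, by abel⟩
    rw [LinearMap.mem_ker, map_sub, hh, sub_self]
  refine hk ?_
  rw [← hh k]
  exact (htop ▸ Submodule.mem_top : (k : P) ∈ LinearMap.ker h)

/-- A module with a linear form whose values are not all in the radical has a nonzero projective
retract. -/
theorem exists_projective_retract [IsArtinianRing A]
    (hJ : Ring.jacobson A * Ring.jacobson A = ⊥) {N : Type u} [AddCommGroup N] [Module A N]
    (f : N →ₗ[A] A) {n : N} (hn : f n ∉ Ring.jacobson A) :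
    ∃ Q : Submodule A A, Module.Projective A Q ∧ Nontrivial Q ∧
      ∃ (a : Q →ₗ[A] N) (b : N →ₗ[A] Q), b ∘ₗ a = LinearMap.id := by
  rw [Ring.jacobson_eq_sInf_isMaximal, Submodule.mem_sInf] at hn
  push Not at hn
  obtain ⟨m, hm, hnm⟩ := hn
  have hsimple : IsSimpleModule A (A ⧸ m) :=
    isSimpleModule_iff_isCoatom.2 (Ideal.isMaximal_def.1 hm)
  obtain ⟨e, -, π, hπ⟩ := exists_isRadicalCover hJ (A ⧸ m)
  have := hπ.projective
  obtain ⟨ψ, hψ⟩ := Module.projective_lifting_property π m.mkQ hπ.surjective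
  have hsurj : Function.Surjective (m.mkQ ∘ₗ f) := LinearMap.surjective_of_ne_zero fun h ↦ hnm (by
    simpa using LinearMap.congr_fun h n)
  have hs : Function.Surjective (ψ ∘ₗ f) := hπ.surjective_of_comp hJ (by
    rwa [← LinearMap.comp_assoc, hψ])
  obtain ⟨a, ha⟩ := Module.projective_lifting_property (ψ ∘ₗ f) LinearMap.id hs
  have := IsSimpleModule.nontrivial A (A ⧸ m)
  exact ⟨_, hπ.projective, hπ.surjective.nontrivial, a, ψ ∘ₗ f, ha⟩

theorem exists_isAcyclicSimple [IsArtinianRing A]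
    (hJ : Ring.jacobson A * Ring.jacobson A = ⊥) {M : Type u} [AddCommGroup M] [Module A M]
    [Module.Finite A M] (hM : ExtVanishes A M) (hproj : ¬ Module.Projective A M) {n : ℕ}
    (i : M →ₗ[A] (Fin n → A)) (hi : Function.Injective i) :
    ∃ S : ModuleCat.{u} A, IsAcyclicSimple A S := by
  obtain ⟨N, ⟨⟨r, hr⟩, hN⟩, hmin⟩ := IsArtinian.set_has_minimal
    {N : Submodule A M | (∃ r : M →ₗ[A] N, r ∘ₗ N.subtype = LinearMap.id) ∧
      ¬ Module.Projective A N} ⟨⊤, ⟨Submodule.topEquiv.symm.toLinearMap, rfl⟩, fun h ↦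
        hproj (Module.Projective.of_equiv Submodule.topEquiv)⟩
  have hr' (x : N) : r x = x := LinearMap.congr_fun hr x
  -- Splitting off `Q` would leave `ker b`, a strictly smaller nonprojective summand of `M`.
  have hretract (Q : Type u) [AddCommGroup Q] [Module A Q] [Module.Projective A Q]
      (a : Q →ₗ[A] N) (b : N →ₗ[A] Q) (hab : b ∘ₗ a = LinearMap.id) : ¬ Nontrivial Q := by
    intro hQ
    have hab' (q : Q) : b (a q) = q := LinearMap.congr_fun hab q
    let c : N →ₗ[A] LinearMap.ker b := (LinearMap.id - a ∘ₗ b).codRestrict _ fun x ↦ by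
      simp [hab']
    have hc (x : N) : (c x : N) = x - a (b x) := rfl
    let N' := (LinearMap.ker b).map N.subtype
    let e : LinearMap.ker b ≃ₗ[A] N' := Submodule.equivMapOfInjective _ N.subtype_injective _
    refine hmin N' ⟨⟨e.toLinearMap ∘ₗ c ∘ₗ r, ?_⟩, fun h ↦ hN ?_⟩ (lt_of_le_of_ne
      (Submodule.map_subtype_le _ _) fun h ↦ ?_)
    · refine LinearMap.ext fun x ↦ ?_
      obtain ⟨x, rfl⟩ := e.surjective x
      have h1 : (e x : M) = (x : N) := rfl
      have h2 : c x = x := Subtype.ext (by rw [hc, LinearMap.mem_ker.1 x.2, map_zero, sub_zero])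
      simp only [LinearMap.comp_apply, Submodule.subtype_apply, h1, hr', h2]
      rfl
    · have : Module.Projective A (LinearMap.ker b) := Module.Projective.of_equiv e.symm
      refine Module.Projective.of_split (c.prod b)
        ((LinearMap.ker b).subtype.coprod a) ?_
      refine LinearMap.ext fun x ↦ ?_
      simp [hc]
    · obtain ⟨q, hq⟩ := exists_ne (0 : Q)
      obtain ⟨x, hx, hxq⟩ := h.ge (a q).2
      rw [← hab' q, ← Subtype.ext hxq] at hq
      exact hq hx
  have hcoord (x : N) (k : Fin n) : i x k ∈ Ring.jacobson A := by
    by_contra h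
    obtain ⟨Q, hQ, hQ', a, b, hab⟩ := exists_projective_retract hJ
      (LinearMap.proj k ∘ₗ i ∘ₗ N.subtype) (n := x) h
    exact hretract Q a b hab hQ'
  have hss : IsSemisimpleModule A N := isSemisimpleModule_of_jacobson_smul fun j hj x ↦ by
    refine Subtype.ext (hi (funext fun k ↦ ?_))
    have := mul_eq_zero_of_mem_jacobson hJ hj (hcoord x k)
    simpa using this
  have : Nontrivial N := by
    by_contra h
    rw [not_nontrivial_iff_subsingleton] at h
    exact hN inferInstance
  obtain ⟨T, hT⟩ := IsSemisimpleModule.exists_simple_submodule A N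
  obtain ⟨s, hs⟩ := IsSemisimpleModule.extension_property T.subtype T.subtype_injective
    LinearMap.id
  exact ⟨ModuleCat.of A T, hT, fun hT' ↦ hretract T T.subtype s hs (IsSimpleModule.nontrivial A T),
    (hM.of_retract N.subtype r hr).of_retract T.subtype s hs⟩

/-- If linear forms extend along all embeddings with simple cokernel, then `A` is injective. -/
theorem injective_of_extVanishes [IsArtinianRing A]
    (h : ∀ m : Ideal A, m.IsMaximal → ExtVanishes A (A ⧸ m)) : Module.Injective A A := by
  refine Module.Baer.injective fun I g ↦ ?_
  obtain ⟨N, ⟨hIN, g', hg'⟩, hmax⟩ := set_has_maximal_iff_noetherian.2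
    (inferInstanceAs (IsNoetherian A A))
    {N : Submodule A A | I ≤ N ∧ ∃ g' : N →ₗ[A] A, ∀ x (hx : x ∈ I) (hN : x ∈ N),
      g' ⟨x, hN⟩ = g ⟨x, hx⟩} ⟨I, le_rfl, g, fun _ _ _ ↦ rfl⟩
  by_cases hN : N = ⊤
  · subst hN
    exact ⟨g' ∘ₗ Submodule.topEquiv.symm.toLinearMap, fun x hx ↦ hg' x hx _⟩
  -- `N' / N` is simple, so the maximal extension extends further.
  · obtain ⟨N', hNN'⟩ := exists_covBy_of_wellFoundedLT (a := N) (by rwa [isMax_iff_eq_top])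
    have hsimple := (covBy_iff_quot_is_simple hNN'.le).1 hNN'
    obtain ⟨m, hm, ⟨e⟩⟩ := isSimpleModule_iff_quot_maximal.1 hsimple
    obtain ⟨g'', hg''⟩ := ((h m hm).of_equiv e.symm).exists_extension
      (Submodule.inclusion hNN'.le) (Submodule.mkQ _) (Submodule.inclusion_injective _)
      (Submodule.mkQ_surjective _) (by
        rw [LinearMap.exact_iff, Submodule.ker_mkQ, Submodule.range_inclusion]) g'
    refine absurd hNN'.lt (hmax N' ⟨hIN.trans hNN'.le, g'', fun x hx hxN' ↦ ?_⟩)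
    rw [← hg' x hx (hIN hx), ← hg'']
    rfl

end AcyclicSimple

/-! ### The central idempotent of a family of simple modules -/

section Block

variable {A : Type u} [Ring A]

theorem mul_mem_iInf_annihilator {ι : Type*} (S : ι → Type u)
    [∀ i, AddCommGroup (S i)] [∀ i, Module A (S i)] {x : A}
    (hx : x ∈ ⨅ i, Module.annihilator A (S i)) (a : A) :
    x * a ∈ ⨅ i, Module.annihilator A (S i) := by
  simp only [Submodule.mem_iInf, Module.mem_annihilator] at hx ⊢
  intro i s
  rw [mul_smul, hx]

theorem mem_jacobson_of_forall_simple {x : A}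
    (h : ∀ (T : Type u) [AddCommGroup T] [Module A T] [IsSimpleModule A T] (t : T), x • t = 0) :
    x ∈ Ring.jacobson A := by
  rw [Ring.jacobson_eq_sInf_isMaximal, Submodule.mem_sInf]
  intro m hm
  have : IsSimpleModule A (A ⧸ m) := isSimpleModule_iff_isCoatom.2 (Ideal.isMaximal_def.1 hm)
  have := h (A ⧸ m) (m.mkQ 1)
  rwa [← map_smul, smul_eq_mul, mul_one, Submodule.mkQ_apply,
    Submodule.Quotient.mk_eq_zero] at this

/-- A family of simple modules is separated from the remaining simple modules by an idempotent. -/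
theorem exists_idempotent_separating [IsArtinianRing A]
    (hJ : Ring.jacobson A * Ring.jacobson A = ⊥) {ι : Type*} (S : ι → Type u) [∀ i, AddCommGroup (S i)]
    [∀ i, Module A (S i)] [∀ i, IsSimpleModule A (S i)] :
    ∃ e : A, IsIdempotentElem e ∧ (∀ i (s : S i), e • s = s) ∧
      ∀ (T : Type u) [AddCommGroup T] [Module A T] [IsSimpleModule A T],
        (∃ i, Nonempty (T ≃ₗ[A] S i)) ∨ ∀ t : T, e • t = 0 := by
  let ι' := {m : Ideal A // m.IsMaximal ∧ ¬ ∃ i, Nonempty ((A ⧸ m) ≃ₗ[A] S i)}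
  have hsimple (m : Ideal A) (hm : m.IsMaximal) : IsSimpleModule A (A ⧸ m) :=
    isSimpleModule_iff_isCoatom.2 (Ideal.isMaximal_def.1 hm)
  have (m : ι') : IsSimpleModule A (A ⧸ m.1) := hsimple _ m.2.1
  set I := ⨅ i, Module.annihilator A (S i)
  set I' := ⨅ m : ι', Module.annihilator A (A ⧸ m.1)
  have hor (T : Type u) [AddCommGroup T] [Module A T] [IsSimpleModule A T] :
      (∃ i, Nonempty (T ≃ₗ[A] S i)) ∨ I' ≤ Module.annihilator A T := by
    obtain ⟨m, hm, ⟨e⟩⟩ := isSimpleModule_iff_quot_maximal.1 ‹IsSimpleModule A T›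
    by_cases h : ∃ i, Nonempty ((A ⧸ m) ≃ₗ[A] S i)
    · obtain ⟨i, ⟨e'⟩⟩ := h
      exact Or.inl ⟨i, ⟨e.trans e'⟩⟩
    · rw [e.annihilator_eq]
      exact Or.inr (iInf_le (fun m : ι' ↦ Module.annihilator A (A ⧸ m.1)) ⟨m, hm, h⟩)
  have hIJ {x : A} (hx : x ∈ I) (hx' : x ∈ I') : x ∈ Ring.jacobson A := by
    refine mem_jacobson_of_forall_simple fun T _ _ _ t ↦ ?_
    obtain ⟨i, ⟨e⟩⟩ | h := hor T
    · refine Module.mem_annihilator.1 ?_ t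
      rw [e.annihilator_eq]
      exact (Submodule.mem_iInf _).1 hx i
    · exact Module.mem_annihilator.1 (h hx') t
  have hJI : Ring.jacobson A ≤ I := le_iInf fun i ↦
    IsSemisimpleModule.jacobson_le_annihilator A (S i)
  have hJI' : Ring.jacobson A ≤ I' := le_iInf fun m ↦
    IsSemisimpleModule.jacobson_le_annihilator A (A ⧸ m.1)
  -- A maximal ideal above both would give a simple module isomorphic to members of both families.
  have hsup : I ⊔ I' = ⊤ := by
    by_contra hne
    obtain ⟨m, hm, hle⟩ := Ideal.exists_le_maximal _ hne
    have := hsimple m hm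
    have hann {L : Ideal A} (hL : L ≤ m) (hLr : ∀ x ∈ L, ∀ a, x * a ∈ L) :
        L ≤ Module.annihilator A (A ⧸ m) := by
      refine fun x hx ↦ Module.mem_annihilator.2 fun s ↦ ?_
      obtain ⟨a, rfl⟩ := m.mkQ_surjective s
      rw [← map_smul, Submodule.mkQ_apply, Submodule.Quotient.mk_eq_zero]
      exact hL (hLr x hx a)
    obtain ⟨i, ⟨e⟩⟩ := exists_equiv_of_iInf_annihilator_le hJ S
      (hann (le_sup_left.trans hle) fun x hx a ↦ mul_mem_iInf_annihilator S hx a)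
    obtain ⟨m', ⟨e'⟩⟩ := exists_equiv_of_iInf_annihilator_le hJ (fun m : ι' ↦ A ⧸ m.1)
      (hann (le_sup_right.trans hle) fun x hx a ↦ mul_mem_iInf_annihilator _ hx a)
    exact m'.2.2 ⟨i, ⟨e'.symm.trans e⟩⟩
  obtain ⟨x, hx, y, hy, hxy⟩ := Submodule.mem_sup.1 (hsup ▸ Submodule.mem_top : (1 : A) ∈ I ⊔ I')
  obtain rfl : x = 1 - y := by rw [← hxy, add_sub_cancel_right]
  obtain ⟨e, he, hey⟩ := exists_idempotent_sub_mem_jacobson hJ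
    (hIJ (I.mul_mem_left y hx) (mul_mem_iInf_annihilator _ hy (1 - y)))
  have heI : 1 - e ∈ I := by
    have := I.sub_mem hx (hJI hey)
    rwa [sub_sub, add_sub_cancel] at this
  have heI' : e ∈ I' := by
    have := I'.add_mem (hJI' hey) hy
    rwa [sub_add_cancel] at this
  refine ⟨e, he, fun i s ↦ ?_, fun T _ _ _ ↦ (hor T).imp_right fun h t ↦
    Module.mem_annihilator.1 (h heI') t⟩
  have := Module.mem_annihilator.1 ((Submodule.mem_iInf _).1 heI i) s
  rw [sub_smul, one_smul, sub_eq_zero] at this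
  exact this.symm

/-- A family of simple modules with vanishing `Ext`, closed under syzygies, each of whose members
is a syzygy of another member, exhausts the simple modules of a connected ring. -/
theorem exists_equiv_of_isConnectedAlgebra [IsArtinianRing A] (hconn : IsConnectedAlgebra A)
    (hJ : Ring.jacobson A * Ring.jacobson A = ⊥) {ι : Type*} [Nonempty ι] {S : ι → Type u}
    [∀ i, AddCommGroup (S i)] [∀ i, Module A (S i)] [∀ i, IsSimpleModule A (S i)]
    (hext : ∀ i, ExtVanishes A (S i))
    (hpred : ∀ i, ∃ j, ∃ (f : A) (π : Submodule.span A {f} →ₗ[A] S j),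
      IsRadicalCover π ∧ Nonempty (S i ≃ₗ[A] LinearMap.ker π))
    (hsucc : ∀ i, ∃ (f : A) (π : Submodule.span A {f} →ₗ[A] S i), IsIdempotentElem f ∧
      IsRadicalCover π ∧ ∃ k, Nonempty (S k ≃ₗ[A] LinearMap.ker π))
    (T : Type u) [AddCommGroup T] [Module A T] [IsSimpleModule A T] :
    ∃ i, Nonempty (T ≃ₗ[A] S i) := by
  obtain ⟨e, he, heS, hor⟩ := exists_idempotent_separating hJ S
  have heS' (i) (s : S i) : (1 - e) • s = 0 := by rw [sub_smul, one_smul, heS, sub_self]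
  have hequiv {T : Type u} [AddCommGroup T] [Module A T] {i} (ε : T ≃ₗ[A] S i) (t : T) :
      (1 - e) • t = 0 := ε.injective (by rw [map_smul, heS', map_zero])
  -- A nonzero `u` generates a semisimple module with a simple summand `T` not killed by `e`, so `T`
  -- is in the family and is the syzygy of some `S j`. Extend its embedding in `A` to the cover of
  -- `S j` and multiply on the right by `1 - e`: the covering map then factors through this
  -- multiplication, yet `1 - e` kills `S j`.
  have h₁ (a : A) : e * a * (1 - e) = 0 := by
    by_contra hu
    set u := e * a * (1 - e) with hu_def
    have huJ : u ∈ Ring.jacobson A := mem_jacobson_of_forall_simple fun T _ _ _ t ↦ by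
      rw [hu_def, mul_smul, mul_smul]
      obtain ⟨i, ⟨ε⟩⟩ | h := hor T
      · rw [hequiv ε, smul_zero, smul_zero]
      · rw [h]
    have heu : e * u = u := by rw [hu_def, ← mul_assoc, ← mul_assoc, he.eq]
    have hue : u * (1 - e) = u := by rw [hu_def, mul_assoc, he.one_sub.eq]
    set U := Submodule.span A {u}
    have huU : u ∈ U := Submodule.mem_span_singleton_self u
    have hss : IsSemisimpleModule A U := isSemisimpleModule_of_jacobson_smul fun j hj x ↦ by
      obtain ⟨b, hb⟩ := Submodule.mem_span_singleton.1 x.2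
      refine Subtype.ext ?_
      rw [Submodule.coe_smul, ← hb, smul_smul, smul_eq_mul,
        mul_eq_zero_of_mem_jacobson hJ ((Ring.jacobson A).mul_mem_right b hj) huJ]
      rfl
    have : Nontrivial U := ⟨⟨u, huU⟩, 0, fun h ↦ hu (congrArg Subtype.val h)⟩
    obtain ⟨T, hT⟩ := IsSemisimpleModule.exists_simple_submodule A U
    obtain ⟨r, hr⟩ := IsSemisimpleModule.extension_property T.subtype T.subtype_injective
      LinearMap.id
    have := IsSimpleModule.nontrivial A T
    set t := r ⟨u, huU⟩ with ht_def
    have ht : t ≠ 0 := by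
      intro h0
      obtain ⟨s, hs⟩ := exists_ne (0 : T)
      obtain ⟨b, hb⟩ := Submodule.mem_span_singleton.1 (s : U).2
      refine hs ?_
      have h1 : r s = s := LinearMap.congr_fun hr s
      have h2 : (s : U) = b • ⟨u, huU⟩ := Subtype.ext hb.symm
      rw [← h1, h2, map_smul, ← ht_def, h0, smul_zero]
    have het : e • t = t := by
      rw [ht_def, ← map_smul]
      exact congrArg r (Subtype.ext heu)
    obtain ⟨i, ⟨ε⟩⟩ | h := hor T
    · obtain ⟨j, f, π, hπ, ⟨δ⟩⟩ := hpred i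
      let κ := ε.trans δ
      obtain ⟨g, hg⟩ := (hext j).exists_extension (LinearMap.ker π).subtype π
        (Submodule.subtype_injective _) hπ.surjective (LinearMap.exact_subtype_ker_map π)
        (U.subtype ∘ₗ T.subtype ∘ₗ κ.symm.toLinearMap)
      have hgt : g (κ t) = (t : U) := by
        have := LinearMap.congr_fun hg (κ t)
        simpa using this
      obtain ⟨b, hb⟩ := Submodule.mem_span_singleton.1 (t : U).2
      obtain ⟨φ, hφ⟩ := hπ.exists_comp_eq hJ (LinearMap.toSpanSingleton A A (1 - e) ∘ₗ g)
        (x := κ t) (κ t).2 (by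
          rw [LinearMap.comp_apply, hgt, LinearMap.toSpanSingleton_apply, ← hb, smul_eq_mul,
            smul_eq_mul, mul_assoc, hue]
          intro h0
          exact ht (Subtype.ext (Subtype.ext (hb.symm.trans h0))))
      have := IsSimpleModule.nontrivial A (S j)
      obtain ⟨s, hs⟩ := exists_ne (0 : S j)
      obtain ⟨p, rfl⟩ := hπ.surjective s
      refine hs ?_
      rw [← hφ, LinearMap.comp_apply, LinearMap.comp_apply, LinearMap.toSpanSingleton_apply,
        map_smul, ← mul_one (1 - e), ← smul_eq_mul (1 - e), map_smul, heS', smul_zero]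
    · exact ht (by rw [← het, h])
  have h₂ (a : A) : (1 - e) * a * e = 0 := by
    let N : Submodule A A :=
      { carrier := {x | ∀ j ∈ Ring.jacobson A, (1 - e) * j * x = 0}
        add_mem' := fun hx hy j hj ↦ by rw [mul_add, hx j hj, hy j hj, add_zero]
        zero_mem' := fun j _ ↦ mul_zero _
        smul_mem' := fun c x hx j hj ↦ by
          rw [smul_eq_mul, ← mul_assoc, mul_assoc (1 - e)]
          exact hx _ ((Ring.jacobson A).mul_mem_right c hj) }
    -- For `S i` covered by `A f`, the radical of `A f` is again in the family, so `(1 - e) J f = 0`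
    -- and `f * c ∈ N`. Simples outside the family are killed by `e`, so they are no quotients of `A
    -- / A (1 - e)`.
    have hsup : N ⊔ Submodule.span A {1 - e} = ⊤ := by
      by_contra hne
      obtain ⟨m, hm, hle⟩ := Ideal.exists_le_maximal _ hne
      have : IsSimpleModule A (A ⧸ m) :=
        isSimpleModule_iff_isCoatom.2 (Ideal.isMaximal_def.1 hm)
      obtain ⟨i, ⟨ε⟩⟩ | h := hor (A ⧸ m)
      · obtain ⟨f, π, hf, hπ, k, ⟨δ⟩⟩ := hsucc i
        have hfmem : f ∈ Submodule.span A {f} := Submodule.mem_span_singleton_self f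
        have hπf : f • π ⟨f, hfmem⟩ = π ⟨f, hfmem⟩ := by
          rw [← map_smul]
          exact congrArg π (Subtype.ext hf.eq)
        have hπf0 : π ⟨f, hfmem⟩ ≠ 0 := by
          intro h0
          have := IsSimpleModule.nontrivial A (S i)
          obtain ⟨s, hs⟩ := exists_ne (0 : S i)
          obtain ⟨p, rfl⟩ := hπ.surjective s
          obtain ⟨b, hb⟩ := Submodule.mem_span_singleton.1 p.2
          refine hs ?_
          have h2 : p = b • ⟨f, hfmem⟩ := Subtype.ext hb.symm
          rw [h2, map_smul, h0, smul_zero]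
        obtain ⟨s, hs⟩ := ε.surjective (π ⟨f, hfmem⟩)
        obtain ⟨c, rfl⟩ := m.mkQ_surjective s
        have hfc : f * c ∈ N := by
          intro j hj
          have hker : j • (⟨f, hfmem⟩ : Submodule.span A {f}) ∈ LinearMap.ker π := by
            rw [LinearMap.mem_ker, map_smul, smul_eq_zero_of_mem_jacobson hj]
          have h0 : (1 - e) * (j * f) = 0 :=
            congrArg (fun z : LinearMap.ker π ↦ ((z : Submodule.span A {f}) : A))
              (hequiv δ.symm ⟨_, hker⟩)
          rw [mul_assoc, ← mul_assoc j, ← mul_assoc, h0, zero_mul]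
        refine hπf0 ?_
        rw [← hπf, ← hs, ← map_smul, ← map_smul, smul_eq_mul, Submodule.mkQ_apply,
          (Submodule.Quotient.mk_eq_zero m).2 (hle (Submodule.mem_sup_left hfc)), map_zero]
      · refine hm.ne_top ((Ideal.eq_top_iff_one m).2 ?_)
        have h1 : e ∈ m := by
          have := h (m.mkQ 1)
          rwa [← map_smul, smul_eq_mul, mul_one, Submodule.mkQ_apply,
            Submodule.Quotient.mk_eq_zero] at this
        have h2 : 1 - e ∈ m :=
          hle (Submodule.mem_sup_right (Submodule.mem_span_singleton_self _))
        simpa using m.add_mem h2 h1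
    obtain ⟨x, hx, y, hy, hxy⟩ := Submodule.mem_sup.1
      (hsup ▸ Submodule.mem_top : (1 : A) ∈ N ⊔ Submodule.span A {1 - e})
    obtain ⟨b, rfl⟩ := Submodule.mem_span_singleton.1 hy
    have hxe : x * e = e := by
      have := congrArg (· * e) hxy
      simpa [add_mul, mul_assoc, sub_mul, he.eq] using this
    have hJa : (1 - e) * a * e ∈ Ring.jacobson A := mem_jacobson_of_forall_simple fun T _ _ _ t ↦ by
      rw [mul_smul, mul_smul]
      obtain ⟨i, ⟨ε⟩⟩ | h := hor T
      · rw [hequiv ε]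
      · rw [h, smul_zero, smul_zero]
    have h0 := hx _ hJa
    calc (1 - e) * a * e = (1 - e) * ((1 - e) * a * e) * x * e := by
          simp only [mul_assoc, hxe, he.eq]
          rw [← mul_assoc (1 - e) (1 - e), he.one_sub.eq]
      _ = 0 := by rw [h0, zero_mul]
  have hcenter : e ∈ Subring.center A := by
    refine Subring.mem_center_iff.2 fun a ↦ ?_
    have h1 := h₁ a
    have h2 := h₂ a
    rw [mul_sub, mul_one, sub_eq_zero] at h1
    rw [sub_mul, sub_mul, one_mul, sub_eq_zero] at h2
    rw [h1, h2]
  obtain rfl | rfl := hconn e hcenter he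
  · obtain ⟨i⟩ := ‹Nonempty ι›
    have := IsSimpleModule.nontrivial A (S i)
    obtain ⟨s, hs⟩ := exists_ne (0 : S i)
    exact absurd (by rw [← heS i s, zero_smul]) hs
  · refine (hor T).resolve_right fun h ↦ ?_
    have := IsSimpleModule.nontrivial A T
    obtain ⟨t, ht⟩ := exists_ne (0 : T)
    exact ht (by rw [← one_smul A t, h])

/-- A connected ring with radical square zero and an acyclic simple module is self-injective. -/
theorem IsAcyclicSimple.isSelfInjective [IsArtinianRing A] (hconn : IsConnectedAlgebra A)
    (hJ : Ring.jacobson A * Ring.jacobson A = ⊥) (S₀ : ModuleCat.{u} A)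
    (hS₀ : IsAcyclicSimple A S₀) : IsSelfInjective A := by
  have hstep (X : {S : ModuleCat.{u} A // IsAcyclicSimple A S}) :
      ∃ (Y : {S : ModuleCat.{u} A // IsAcyclicSimple A S}) (f : A)
        (π : Submodule.span A {f} →ₗ[A] X.1), IsIdempotentElem f ∧ IsRadicalCover π ∧
          Nonempty (Y.1 ≃ₗ[A] LinearMap.ker π) := by
    have := X.2.simple
    obtain ⟨f, hf, π, hπ⟩ := exists_isRadicalCover hJ X.1
    exact ⟨⟨ModuleCat.of A (LinearMap.ker π), X.2.ker hJ hπ _ (Submodule.subtype_injective _)⟩,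
      f, π, hf, hπ, ⟨LinearEquiv.refl _ _⟩⟩
  choose Ω f π hf hπ hΩ using hstep
  let S (n : ℕ) := Ω^[n] ⟨S₀, hS₀⟩
  have hS (n : ℕ) : S (n + 1) = Ω (S n) := Function.iterate_succ_apply' _ _ _
  have (n : ℕ) : IsSimpleModule A (S n).1 := (S n).2.simple
  -- Annihilators of the tails increase. Once they stabilize, `S n` is isomorphic to a later term,
  -- which replaces any finiteness count of simples.
  let I : ℕ →o Ideal A :=
    { toFun := fun n ↦ ⨅ k, Module.annihilator A (S (n + k)).1
      monotone' := by
        refine monotone_nat_of_le_succ fun n ↦ le_iInf fun k ↦ ?_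
        refine (iInf_le _ (k + 1)).trans (le_of_eq ?_)
        rw [show n + (k + 1) = n + 1 + k by ring] }
  obtain ⟨n, hn⟩ := monotone_stabilizes_iff_noetherian.2 (inferInstanceAs (IsNoetherian A A)) I
  have hle : ⨅ k, Module.annihilator A (S (n + 1 + k)).1 ≤ Module.annihilator A (S n).1 := by
    have h := hn (n + 1) n.le_succ
    exact h.ge.trans (iInf_le _ 0)
  obtain ⟨k, ⟨δ⟩⟩ := exists_equiv_of_iInf_annihilator_le hJ
    (fun k ↦ (S (n + 1 + k)).1) hle
  have hall := exists_equiv_of_isConnectedAlgebra hconn hJ (S := fun k ↦ (S (n + k)).1)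
    (fun k ↦ (S (n + k)).2.extVanishes) (fun i ↦ by
      -- Only the first member needs the recurrence: `S n ≅ S (n + k + 1)` is the syzygy of `S (n +
      -- k)`.
      have key : ∃ j, Nonempty ((S (n + i)).1 ≃ₗ[A] (Ω (S (n + j))).1) := by
        cases i with
        | zero => exact ⟨k, ⟨by rw [← hS, add_right_comm]; exact δ⟩⟩
        | succ i => exact ⟨i, ⟨by rw [← hS, add_assoc]⟩⟩
      obtain ⟨j, ⟨δ⟩⟩ := key
      exact ⟨j, _, _, hπ _, ⟨δ.trans (hΩ _).some⟩⟩)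
    (fun i ↦ ⟨_, _, hf _, hπ _, i + 1, by
      have := hΩ (S (n + i))
      rwa [← hS, add_assoc] at this⟩)
  refine injective_of_extVanishes fun m hm ↦ ?_
  have : IsSimpleModule A (A ⧸ m) := isSimpleModule_iff_isCoatom.2 (Ideal.isMaximal_def.1 hm)
  obtain ⟨i, ⟨ε⟩⟩ := hall (A ⧸ m)
  exact (S (n + i)).2.extVanishes.of_equiv ε.symm

end Block

/-! ### The dichotomy -/

theorem mainTheorem3 (R : Type*) [CommRing R] [IsArtinianRing R] (A : Type u) [Ring A]
    [Algebra R A] [Module.Finite R A] (hconn : IsConnectedAlgebra A)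
    (hrad : Ring.jacobson A * Ring.jacobson A = ⊥) : IsSelfInjective A ∨ IsCMFree A := by
  have : IsArtinianRing A := isArtinian_of_tower R inferInstance
  refine or_iff_not_imp_left.2 fun hA M _ _ _ ↦
    ⟨?_, fun _ ↦ IsGorensteinProjective.of_projective M⟩
  rintro ⟨P, hP, ⟨e⟩⟩
  by_contra hM
  have := hP.finite 0
  have := hP.projective 0
  obtain ⟨n, -, i, -, hi, -⟩ := Module.Finite.exists_comp_eq_id_of_projective A (P.X 0)
  obtain ⟨S, hS⟩ := exists_isAcyclicSimple hrad ((hP.extVanishes 0).of_equiv e.symm) hM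
    (i ∘ₗ (LinearMap.ker (P.d 0 1).hom).subtype ∘ₗ e.toLinearMap)
    (hi.comp ((Submodule.subtype_injective _).comp e.injective))
  exact hA (hS.isSelfInjective hconn hrad)
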